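/- Work in (single-sorted) logic of metric structures: structures are nonempty complete metric spaces of diameter at most $1$, formulas are $[0,1]$-valued, and every function and predicate symbol carries a fixed modulus of uniform continuity. Let $L$ be a separable language, that is, for every $n$ the space of $L$-formulas in $x_0,\dots,x_{n-1}$ is separable for the norm $\|\phi\|_\infty=\sup_{M,\bar a}|\phi(\bar a)^M|$ ($M$ ranges over all $L$-structures, $\bar a$ over the $n$-tuples in $M$). Let $\hat{\mathcal M}(L)$ be the space of codes of separable $L$-structures. With $D$ the set of closed terms of the language obtained from $L$ by adding new constants $d_j$, $j\in\mathbb N$, a code $\gamma$ consists of a pseudometric $\gamma\colon D^2\to[0,1]$ and functions $\gamma_R\colon D^k\to[0,1]$, one for each $k$-ary predicate symbol $R$ of $L$, such that the operations $(t_1,\dots,t_k)\mapsto f(t_1,\dots,t_k)$ on $D$, for function symbols $f$ of $L$, and the functions $\gamma_R$ respect the prescribed moduli of uniform continuity with respect to $\gamma$. The topology on $\hat{\mathcal M}(L)$ is that of pointwise convergence, and $M(\gamma)$ is the $L$-structure obtained by completing $D$ with respect to $\gamma$ (identifying points at distance $0$). For an $L$-theory $\mathbf T$ (a set of sentences; $M\models\mathbf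 T$ if all of them have value $0$ in $M$), the space of separable models of $\mathbf T$ is the subspace $\{\gamma\in\hat{\mathcal M}(L): M(\gamma)\models\mathbf T\}$. A sequence $\langle \mathbf t_n:n\in\mathbb N\rangle$ of $m$-ary types is \emph{uniform} if there are $m$-ary formulas $\phi_i$, $i\in\mathbb N$, all with the same modulus of uniform continuity, such that $\mathbf t_n=\{\phi_i(\bar x)\ge 2^{-n}: i\in\mathbb N\}$ for every $n$. A class $\mathfrak M$ of separable models of $\mathbf T$ is \emph{uniformly definable by omitting types} if there is a countable family of uniform sequences of types (of possibly different arities) such that a separable model of $\mathbf T$ belongs to $\mathfrak M$ if and only if it omits all the types in all of these sequences. **Proposition.** Let $\mathbf T$ be a theory in a separable language $L$. Then the space of separable models of $\mathbf T$ is a standard Borel space, and for every class $\mathfrak M$ of separable models of $\mathbf T$ that is uniformly definable by omitting types, the set of all $\gamma$ in this space with $M(\gamma)\in\mathfrak M$ is Borel. -/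

import Mathlib

universe u

open scoped unitInterval

noncomputable section

/-! ### Moduli of uniform continuity -/

/-- A modulus of uniform continuity `Δ : (0,1] → (0,1]`. -/
abbrev Modulus : Type := Set.Ioc (0 : ℝ) 1 → Set.Ioc (0 : ℝ) 1

/-- `f` respects the modulus `Δ`: for the maximum metric on `X ^ k`, `d(x,y) < Δ(ε)` implies
`d(f(x), f(y)) ≤ ε`. -/
def RespectsModulus {X Y : Type*} [PseudoMetricSpace X] [PseudoMetricSpace Y] (Δ : Modulus)
    {k : ℕ} (f : (Fin k → X) → Y) : Prop :=
  ∀ (ε : Set.Ioc (0 : ℝ) 1) (x y : Fin k → X),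
    (∀ i, dist (x i) (y i) < (Δ ε : ℝ)) → dist (f x) (f y) ≤ (ε : ℝ)

/-! ### Languages, structures and formulas of (single-sorted) logic of metric structures -/

/-- A language of the logic of metric structures: function and predicate symbols of all finite
arities (constants are the function symbols of arity `0`), each with a fixed modulus of uniform
continuity.  The distinguished symbol for the metric is a logical symbol. -/
structure MetricLanguage extends FirstOrder.Language.{u, u} where
  funModulus : ∀ {k : ℕ}, toLanguage.Functions k → Modulus
  relModulus : ∀ {k : ℕ}, toLanguage.Relations k → Modulus

namespace MetricLanguage

/-- Terms with variables in `α`. -/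
abbrev Term (L : MetricLanguage.{u}) (α : Type) : Type u := L.toLanguage.Term α

/-- An `L`-structure: a nonempty complete metric space of diameter at most `1`, with
interpretations of the symbols of `L` that respect the prescribed moduli. -/
structure Str (L : MetricLanguage.{u}) : Type (u + 1) where
  carrier : Type u
  [metric : MetricSpace carrier]
  [complete : CompleteSpace carrier]
  [nonempty : Nonempty carrier]
  dist_le_one : ∀ x y : carrier, dist x y ≤ 1
  funMap : ∀ {k : ℕ}, L.Functions k → (Fin k → carrier) → carrier
  relMap : ∀ {k : ℕ}, L.Relations k → (Fin k → carrier) → I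
  funMap_respects : ∀ {k : ℕ} (f : L.Functions k), RespectsModulus (L.funModulus f) (funMap f)
  relMap_respects : ∀ {k : ℕ} (R : L.Relations k), RespectsModulus (L.relModulus R) (relMap R)

instance (L : MetricLanguage.{u}) : CoeSort L.Str (Type u) := ⟨Str.carrier⟩
instance {L : MetricLanguage.{u}} (M : L.Str) : MetricSpace M := M.metric
instance {L : MetricLanguage.{u}} (M : L.Str) : CompleteSpace M := M.complete
instance {L : MetricLanguage.{u}} (M : L.Str) : Nonempty M := M.nonempty

/-- Interpretation of a term under an assignment of its variables. -/
def Str.termVal {L : MetricLanguage.{u}} (M : L.Str) {α : Type} (v : α → M) : L.Term α → M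
  | .var a => v a
  | .func f ts => M.funMap f fun i => M.termVal v (ts i)

/-- `L.Formula n` is the set of `[0,1]`-valued `L`-formulas whose free variables are among
`x_0, …, x_{n-1}`.  Connectives are all continuous functions `[0,1]^k → [0,1]`; the quantifiers
`sup` and `inf` bind the last variable. -/
inductive Formula (L : MetricLanguage.{u}) : ℕ → Type u
  | dist {n : ℕ} (s t : L.Term (Fin n)) : Formula L n
  | rel {n k : ℕ} (R : L.Relations k) (ts : Fin k → L.Term (Fin n)) : Formula L n
  | conn {n k : ℕ} (c : C(Fin k → I, I)) (φs : Fin k → Formula L n) : Formula L n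
  | sup {n : ℕ} (φ : Formula L (n + 1)) : Formula L n
  | inf {n : ℕ} (φ : Formula L (n + 1)) : Formula L n

/-- The value `φ(a)^M`. -/
def Str.eval {L : MetricLanguage.{u}} (M : L.Str) : {n : ℕ} → L.Formula n → (Fin n → M) → I
  | _, .dist s t, a => ⟨Dist.dist (M.termVal a s) (M.termVal a t), dist_nonneg, M.dist_le_one _ _⟩
  | _, .rel R ts, a => M.relMap R fun i => M.termVal a (ts i)
  | _, .conn c φs, a => c fun i => M.eval (φs i) a
  | _, .sup φ, a => ⨆ b : M, M.eval φ (Fin.snoc a b)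
  | _, .inf φ, a => ⨅ b : M, M.eval φ (Fin.snoc a b)

/-- `‖φ - ψ‖_∞ ≤ r`, where the norm is the supremum over all `L`-structures `M` and all tuples
in `M`. -/
def Formula.NormSubLE {L : MetricLanguage.{u}} {n : ℕ} (φ ψ : L.Formula n) (r : ℝ) : Prop :=
  ∀ (M : L.Str) (a : Fin n → M), |(M.eval φ a : ℝ) - M.eval ψ a| ≤ r

/-- The language `L` is separable: for every `n` the space of formulas in `x_0, …, x_{n-1}` is
separable with respect to `‖·‖_∞`. -/
def IsSeparable (L : MetricLanguage.{u}) : Prop :=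
  ∀ n : ℕ, ∃ S : Set (L.Formula n), S.Countable ∧
    ∀ (φ : L.Formula n) (r : ℝ), 0 < r → ∃ ψ ∈ S, φ.NormSubLE ψ r

/-- A theory is a set of sentences. -/
abbrev Theory (L : MetricLanguage.{u}) : Type u := Set (L.Formula 0)

/-- `M` is a model of `T`: all sentences of `T` have value `0` in `M`. -/
def Str.Models {L : MetricLanguage.{u}} (M : L.Str) (T : L.Theory) : Prop :=
  ∀ φ ∈ T, M.eval φ Fin.elim0 = 0

/-! ### Types -/

/-- A closed condition `φ(x_0, …, x_{n-1}) ∈ K`, with `K ⊆ ℝ` closed. -/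
structure Condition (L : MetricLanguage.{u}) (n : ℕ) : Type u where
  formula : L.Formula n
  set : Set ℝ
  isClosed : IsClosed set

/-- The condition `φ(x) ≥ r`. -/
def Formula.ge {L : MetricLanguage.{u}} {n : ℕ} (φ : L.Formula n) (r : ℝ) : L.Condition n :=
  ⟨φ, Set.Ici r, isClosed_Ici⟩

/-- A (partial) type in the variables `x_0, …, x_{n-1}` is a set of closed conditions. -/
abbrev PartialType (L : MetricLanguage.{u}) (n : ℕ) : Type u := Set (L.Condition n)

/-- The tuple `a` realizes the type `t` in `M`. -/
def Str.Realizes {L : MetricLanguage.{u}} (M : L.Str) {n : ℕ} (a : Fin n → M)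
    (t : L.PartialType n) : Prop :=
  ∀ c ∈ t, (M.eval c.formula a : ℝ) ∈ c.set

/-- `M` omits the type `t`. -/
def Str.Omits {L : MetricLanguage.{u}} (M : L.Str) {n : ℕ} (t : L.PartialType n) : Prop :=
  ¬ ∃ a : Fin n → M, M.Realizes a t

/-- `Δ` is a modulus of uniform continuity of the formula `φ` (in every `L`-structure). -/
def Formula.HasModulus {L : MetricLanguage.{u}} {n : ℕ} (φ : L.Formula n) (Δ : Modulus) : Prop :=
  ∀ M : L.Str, RespectsModulus Δ (M.eval φ)

/-- A sequence `t_0, t_1, …` of `n`-ary types is uniform if there are `n`-ary formulas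
`φ_0, φ_1, …`, all with the same modulus of uniform continuity, such that
`t_j = {φ_i ≥ 2 ^ (-j) : i ∈ ℕ}` for every `j`. -/
def IsUniformSequence {L : MetricLanguage.{u}} {n : ℕ} (t : ℕ → L.PartialType n) : Prop :=
  ∃ φ : ℕ → L.Formula n,
    (∀ j : ℕ, t j = Set.range fun i => (φ i).ge ((2 : ℝ)⁻¹ ^ j)) ∧
    ∃ Δ : Modulus, ∀ i, (φ i).HasModulus Δ

/-- `𝔐` is a class of separable models of `T` that is uniformly definable by omitting types: there
is a countable family of uniform sequences of types such that a separable model of `T` is in `𝔐`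
if and only if it omits all of these types. -/
def UniformlyDefinableByOmittingTypes {L : MetricLanguage.{u}} (T : L.Theory)
    (𝔐 : Set L.Str) : Prop :=
  ∃ (J : Type) (_ : Countable J) (n : J → ℕ) (t : (m : J) → ℕ → L.PartialType (n m)),
    (∀ m, IsUniformSequence (t m)) ∧
    ∀ M : L.Str, M ∈ 𝔐 ↔
      TopologicalSpace.SeparableSpace M ∧ M.Models T ∧ ∀ m j, M.Omits (t m j)

/-! ### The space of separable structures

The new constants `d_0, d_1, …` are the variables of the terms in `L.Term ℕ`, so that `L.Term ℕ` is
the set of closed terms of the language `L ∪ {d_j : j ∈ ℕ}`. -/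

/-- The product of copies of `[0,1]` in which structures are coded: a function of two terms (the
metric) and, for every `k`-ary predicate symbol, a function of `k` terms. -/
abbrev RawCode (L : MetricLanguage.{u}) : Type u :=
  (L.Term ℕ → L.Term ℕ → I) × ((R : Σ k, L.Relations k) → (Fin R.1 → L.Term ℕ) → I)

/-- `γ` is a code: its first component is a (pseudo)metric on the set of terms, and the function
and predicate symbols respect their moduli with respect to it. -/
structure IsCode {L : MetricLanguage.{u}} (γ : L.RawCode) : Prop where
  self : ∀ s, γ.1 s s = 0
  symm : ∀ s t, γ.1 s t = γ.1 t s
  triangle : ∀ s t r, (γ.1 s r : ℝ) ≤ γ.1 s t + γ.1 t r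
  func : ∀ {k : ℕ} (f : L.Functions k) (ε : Set.Ioc (0 : ℝ) 1) (s t : Fin k → L.Term ℕ),
    (∀ i, (γ.1 (s i) (t i) : ℝ) < (L.funModulus f ε : ℝ)) →
      (γ.1 (.func f s) (.func f t) : ℝ) ≤ ε
  rel : ∀ {k : ℕ} (R : L.Relations k) (ε : Set.Ioc (0 : ℝ) 1) (s t : Fin k → L.Term ℕ),
    (∀ i, (γ.1 (s i) (t i) : ℝ) < (L.relModulus R ε : ℝ)) →
      |(γ.2 ⟨k, R⟩ s : ℝ) - γ.2 ⟨k, R⟩ t| ≤ ε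

/-- The space of (codes of) separable `L`-structures. -/
def Code (L : MetricLanguage.{u}) : Type u := {γ : L.RawCode // IsCode γ}

/-- The topology induced by the product topology. -/
instance (L : MetricLanguage.{u}) : TopologicalSpace L.Code :=
  inferInstanceAs (TopologicalSpace {γ : L.RawCode // IsCode γ})

instance (L : MetricLanguage.{u}) : MeasurableSpace L.Code := borel _

instance (L : MetricLanguage.{u}) : BorelSpace L.Code := ⟨rfl⟩

namespace Code

variable {L : MetricLanguage.{u}}

/-- The set of terms, with the pseudometric coded by `γ`. -/
def Pre (_ : L.Code) : Type u := L.Term ℕ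

instance (γ : L.Code) : Nonempty γ.Pre := ⟨(.var 0 : L.Term ℕ)⟩

instance (γ : L.Code) : PseudoMetricSpace γ.Pre where
  dist s t := (γ.1.1 s t : ℝ)
  dist_self s := by simp [γ.2.self s]
  dist_comm s t := by rw [γ.2.symm s t]
  dist_triangle s t r := γ.2.triangle s t r

instance (γ : L.Code) : Nonempty (UniformSpace.Completion γ.Pre) :=
  (inferInstance : Nonempty γ.Pre).map (↑)

/-- Interpretation of a function symbol on terms. -/
def preFun (γ : L.Code) {k : ℕ} (f : L.Functions k) (s : Fin k → γ.Pre) : γ.Pre :=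
  FirstOrder.Language.Term.func f s

/-- Interpretation of a predicate symbol on terms. -/
def preRel (γ : L.Code) {k : ℕ} (R : L.Relations k) (s : Fin k → γ.Pre) : I := γ.1.2 ⟨k, R⟩ s

theorem preFun_respects (γ : L.Code) {k : ℕ} (f : L.Functions k) :
    RespectsModulus (L.funModulus f) (γ.preFun f) := γ.2.func f

theorem preRel_respects (γ : L.Code) {k : ℕ} (R : L.Relations k) :
    RespectsModulus (L.relModulus R) (γ.preRel R) := γ.2.rel R

end Code

end MetricLanguage

open UniformSpace in
/-- The inclusion of `X ^ k` into the `k`-th power of the completion of `X`. -/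
theorem isDenseInducing_pi_completion (X : Type*) [PseudoMetricSpace X] (k : ℕ) :
    IsDenseInducing (fun (x : Fin k → X) (i : Fin k) => (x i : Completion X)) :=
  ⟨Topology.IsInducing.piMap fun _ => Completion.isDenseInducing_coe.isInducing,
    DenseRange.piMap fun _ => Completion.denseRange_coe⟩

open UniformSpace in
/-- The continuous extension of `f : X ^ k → Y` to the completion of `X`. -/
def extendCompletion {X Y : Type*} [PseudoMetricSpace X] [TopologicalSpace Y] [Nonempty Y]
    {k : ℕ} (f : (Fin k → X) → Y) : (Fin k → Completion X) → Y :=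
  (isDenseInducing_pi_completion X k).extend f

theorem RespectsModulus.uniformContinuous {X Y : Type*} [PseudoMetricSpace X]
    [PseudoMetricSpace Y] {Δ : Modulus} {k : ℕ} {f : (Fin k → X) → Y}
    (h : RespectsModulus Δ f) : UniformContinuous f := by
  rw [Metric.uniformContinuous_iff]
  intro ε hε
  let e : Set.Ioc (0 : ℝ) 1 := ⟨min (ε / 2) 1, by positivity, min_le_right _ _⟩
  refine ⟨Δ e, (Δ e).2.1, fun x y hxy => ?_⟩
  have h1 := h e x y fun i => (dist_le_pi_dist x y i).trans_lt hxy
  have h2 : (e : ℝ) ≤ ε / 2 := min_le_left _ _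
  linarith

theorem extendCompletion_spec {X Y : Type*} [PseudoMetricSpace X] [MetricSpace Y]
    [CompleteSpace Y] [Nonempty Y] {Δ : Modulus} {k : ℕ} {f : (Fin k → X) → Y}
    (h : RespectsModulus Δ f) :
    UniformContinuous (extendCompletion f) ∧
      ∀ x : Fin k → X, extendCompletion f (fun i => (x i : UniformSpace.Completion X)) = f x := by
  have hi : Isometry (fun (x : Fin k → X) (i : Fin k) => (x i : UniformSpace.Completion X)) :=
    Isometry.piMap _ fun _ => UniformSpace.Completion.coe_isometry
  have hd := (isDenseInducing_pi_completion X k).dense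
  exact ⟨uniformContinuous_uniformly_extend hi.isUniformInducing hd h.uniformContinuous,
    fun x => (isDenseInducing_pi_completion X k).extend_eq h.uniformContinuous.continuous x⟩

theorem RespectsModulus.extendCompletion {X Y : Type*} [PseudoMetricSpace X] [MetricSpace Y]
    [CompleteSpace Y] [Nonempty Y] {Δ : Modulus} {k : ℕ} {f : (Fin k → X) → Y}
    (h : RespectsModulus Δ f) : RespectsModulus Δ (extendCompletion f) := by
  obtain ⟨hc, he⟩ := extendCompletion_spec h
  intro ε
  by_contra! hcon
  obtain ⟨x, y, hxy, hlt⟩ := hcon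
  let U : Set ((Fin k → UniformSpace.Completion X) × (Fin k → UniformSpace.Completion X)) :=
    {p | (∀ i, dist (p.1 i) (p.2 i) < (Δ ε : ℝ)) ∧
      (ε : ℝ) < dist (_root_.extendCompletion f p.1) (_root_.extendCompletion f p.2)}
  have hU : IsOpen U := by
    refine IsOpen.and ?_ ?_
    · rw [Set.ofPred_forall]
      exact isOpen_iInter_of_finite fun i => isOpen_lt (by fun_prop) continuous_const
    · exact isOpen_lt continuous_const
        ((hc.continuous.comp continuous_fst).dist (hc.continuous.comp continuous_snd))
  have hd := (isDenseInducing_pi_completion X k).dense.prodMap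
    (isDenseInducing_pi_completion X k).dense
  obtain ⟨⟨a, b⟩, hab1, hab2⟩ := hd.exists_mem_open hU ⟨(x, y), hxy, hlt⟩
  simp only [Prod.map_apply, he, UniformSpace.Completion.dist_eq] at hab1 hab2
  exact absurd (h ε a b hab1) (not_le.2 hab2)

namespace MetricLanguage

/-- The separable `L`-structure `M(γ)` coded by `γ`: the (Hausdorff) completion of the set of terms
with the pseudometric given by `γ`, the symbols of `L` being interpreted by continuity. -/
def Code.model {L : MetricLanguage.{u}} (γ : L.Code) : L.Str where
  carrier := UniformSpace.Completion γ.Pre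
  dist_le_one x y := by
    induction x, y using UniformSpace.Completion.induction_on₂ with
    | hp => exact isClosed_le (by fun_prop) continuous_const
    | ih s t =>
      rw [UniformSpace.Completion.dist_eq]
      exact (γ.1.1 s t).2.2
  funMap f := extendCompletion fun s => (γ.preFun f s : UniformSpace.Completion γ.Pre)
  relMap R := extendCompletion (γ.preRel R)
  funMap_respects f := RespectsModulus.extendCompletion fun ε s t h => by
    rw [UniformSpace.Completion.dist_eq]
    exact γ.preFun_respects f ε s t h
  relMap_respects R := (γ.preRel_respects R).extendCompletion

/-- The space of (codes of) separable models of `T`. -/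
abbrev ModelSpace {L : MetricLanguage.{u}} (T : L.Theory) : Type u :=
  {γ : L.Code // γ.model.Models T}

end MetricLanguage

end

open scoped unitInterval

/-! ### Suprema and infima in the unit interval -/

namespace unitInterval

/-! Separability of `L` leaves only countably many symbols, since distinct symbols of the same arity
yield formulas at distance 1. Hence there are countably many terms, and the codes form a closed
subset of a countable power of `[0,1]`, a Polish space.

For fixed terms, the value of a formula in `M(γ)` is a Borel function of `γ`
(`Code.measurable_eval`): terms are dense in `M(γ)` and formulas are continuous, so each quantifier
is a countable supremum or infimum. A theory is equivalent to a countable dense part of itself, so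
its models form a Borel, hence standard Borel, set.

Omitting a type quantifies over all tuples of `M(γ)`, which is a priori only a coanalytic condition.
Uniformity removes this obstacle (`Code.omits_iff`): with a common modulus, a tuple may be replaced
by nearby terms at the cost of passing from `2⁻ʲ` to `2⁻ʲ⁻¹`, and omitting the whole sequence
becomes a condition on countably many tuples of terms. -/

theorem dist_iSup_le {ι : Type*} {f g : ι → I} {r : ℝ} (hr : 0 ≤ r)
    (h : ∀ i, dist (f i) (g i) ≤ r) : dist (⨆ i, f i) (⨆ i, g i) ≤ r := by
  have key : ∀ f g : ι → I, (∀ i, dist (f i) (g i) ≤ r) →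
      ((⨆ i, f i : I) : ℝ) ≤ (⨆ i, g i : I) + r := by
    intro f g h
    -- The sum may exceed 1; projecting it back gives an upper bound in the lattice `I`.
    have hle : (⨆ i, f i) ≤ Set.projIcc (0 : ℝ) 1 zero_le_one ((⨆ i, g i : I) + r) := by
      refine iSup_le fun i => ?_
      rw [← Subtype.coe_le_coe, Set.coe_projIcc]
      have h1 : (g i : ℝ) ≤ (⨆ i, g i : I) := le_iSup g i
      have h2 := (abs_le.1 (h i)).2
      exact le_max_of_le_right (le_min (f i).2.2 (by linarith))
    rw [← Subtype.coe_le_coe, Set.coe_projIcc] at hle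
    exact hle.trans (max_le (add_nonneg (⨆ i, g i : I).2.1 hr) (min_le_right _ _))
  have h1 := key f g h
  have h2 := key g f fun i => by rw [dist_comm]; exact h i
  exact abs_le.2 ⟨by linarith, by linarith⟩

theorem dist_iInf_le {ι : Type*} {f g : ι → I} {r : ℝ} (hr : 0 ≤ r)
    (h : ∀ i, dist (f i) (g i) ≤ r) : dist (⨅ i, f i) (⨅ i, g i) ≤ r := by
  have key : ∀ f g : ι → I, (∀ i, dist (f i) (g i) ≤ r) →
      ((⨅ i, f i : I) : ℝ) - r ≤ (⨅ i, g i : I) := by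
    intro f g h
    have hle : Set.projIcc (0 : ℝ) 1 zero_le_one ((⨅ i, f i : I) - r) ≤ ⨅ i, g i := by
      refine le_iInf fun i => ?_
      rw [← Subtype.coe_le_coe, Set.coe_projIcc]
      have h1 : ((⨅ i, f i : I) : ℝ) ≤ f i := iInf_le f i
      have h2 := (abs_le.1 (h i)).2
      exact max_le (g i).2.1 (min_le_of_right_le (by linarith))
    rw [← Subtype.coe_le_coe, Set.coe_projIcc] at hle
    refine le_trans (le_max_of_le_right (le_min ?_ le_rfl)) hle
    linarith [(⨅ i, f i : I).2.2]
  have h1 := key f g h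
  have h2 := key g f fun i => by rw [dist_comm]; exact h i
  exact abs_le.2 ⟨by linarith, by linarith⟩

end unitInterval

/-- The points where `f` lies below a given bound form a closed set, so a bound on a dense set holds
everywhere. -/
theorem DenseRange.iSup_comp_of_continuous {ι X α : Type*} [TopologicalSpace X]
    [CompleteLattice α] [TopologicalSpace α] [OrderClosedTopology α] {e : ι → X}
    (he : DenseRange e) {f : X → α} (hf : Continuous f) : ⨆ x, f x = ⨆ i, f (e i) := by
  refine le_antisymm (iSup_le fun x => ?_) (iSup_comp_le f e)
  refine he.induction_on (p := fun x => f x ≤ ⨆ i, f (e i)) x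
    (isClosed_le hf continuous_const) fun i => le_iSup (fun i => f (e i)) i

theorem DenseRange.iInf_comp_of_continuous {ι X α : Type*} [TopologicalSpace X]
    [CompleteLattice α] [TopologicalSpace α] [OrderClosedTopology α] {e : ι → X}
    (he : DenseRange e) {f : X → α} (hf : Continuous f) : ⨅ x, f x = ⨅ i, f (e i) := by
  refine le_antisymm (le_iInf_comp f e) (le_iInf fun x => ?_)
  refine he.induction_on (p := fun x => ⨅ i, f (e i) ≤ f x) x
    (isClosed_le continuous_const hf) fun i => iInf_le (fun i => f (e i)) i

namespace MetricLanguage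

variable {L : MetricLanguage.{u}}

/-! ### Separable languages are countable -/

theorem respectsModulus_const {X Y : Type*} [PseudoMetricSpace X] [PseudoMetricSpace Y]
    (Δ : Modulus) {k : ℕ} (c : Y) : RespectsModulus Δ fun _ : Fin k → X => c := by
  intro ε _ _ _
  rw [dist_self]
  exact ε.2.1.le

/-- The structure on the unit interval in which all symbols are interpreted by constant maps. -/
def Str.const (F : ∀ {k : ℕ}, L.Functions k → I) (P : ∀ {k : ℕ}, L.Relations k → I) : L.Str where
  carrier := ULift.{u} I
  dist_le_one x y := by
    rw [ULift.dist_eq]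
    exact abs_le.2 ⟨by linarith [x.down.2.1, y.down.2.2], by linarith [x.down.2.2, y.down.2.1]⟩
  funMap f _ := ⟨F f⟩
  relMap R _ := P R
  funMap_respects _ := respectsModulus_const _ _
  relMap_respects _ := respectsModulus_const _ _

/-- A family of formulas that lie at mutual distance `1` is countable if `L` is separable. -/
theorem IsSeparable.countable_of_separated (hL : L.IsSeparable) {n : ℕ} {ι : Type*}
    (φ : ι → L.Formula n)
    (h : ∀ i j, i ≠ j → ∃ (M : L.Str) (a : Fin n → M), M.eval (φ i) a = 1 ∧ M.eval (φ j) a = 0) :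
    Countable ι := by
  obtain ⟨S, hS, hd⟩ := hL n
  -- With a tolerance below 1/2, no single formula approximates two members of the family.
  choose ψ hψ hn using fun i => hd (φ i) (1 / 3) (by norm_num)
  have := hS.to_subtype
  refine Function.Injective.countable (f := fun i => (⟨ψ i, hψ i⟩ : S)) fun i j hij => ?_
  by_contra hne
  obtain ⟨M, a, h1, h0⟩ := h i j hne
  have hi := abs_le.1 (hn i M a)
  have hj := abs_le.1 (hn j M a)
  have hij : ψ i = ψ j := congrArg Subtype.val hij
  rw [h1, hij] at hi
  rw [h0] at hj
  simp only [Set.Icc.coe_one, Set.Icc.coe_zero] at hi hj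
  linarith [hi.2, hj.1]

theorem IsSeparable.countable_relations (hL : L.IsSeparable) (k : ℕ) :
    Countable (L.Relations k) := by
  classical
  refine hL.countable_of_separated (n := 1) (fun R => .rel R fun _ => .var 0) fun R R' hne => ?_
  -- Only `R` is interpreted as 1; symbols are compared in the sigma type because `k'` varies.
  refine ⟨Str.const (fun _ => 0) fun {k'} Q => if (⟨k', Q⟩ : Σ k, L.Relations k) = ⟨k, R⟩ then 1
    else 0, fun _ => ⟨0⟩, if_pos rfl, if_neg fun h => hne ?_⟩
  simpa using h.symm

theorem IsSeparable.countable_functions (hL : L.IsSeparable) (k : ℕ) :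
    Countable (L.Functions k) := by
  classical
  refine hL.countable_of_separated (n := 1)
    (fun f => .dist (.func f fun _ => .var 0) (.var 0)) fun f f' hne => ?_
  -- Only `f` takes the value 1, so the distance to the point 0 tells it from every other symbol.
  let M : L.Str := Str.const
    (fun {k'} g => if (⟨k', g⟩ : Σ k, L.Functions k) = ⟨k, f⟩ then 1 else 0) fun _ => 0
  have hf : ∀ g : L.Functions k, ∀ b : I, (if (⟨k, g⟩ : Σ k, L.Functions k) = ⟨k, f⟩ then (1 : I)
      else 0) = b → M.eval (.dist (.func g fun _ => .var 0) (.var 0)) (fun _ : Fin 1 => ⟨0⟩) = b := by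
    intro g b hb
    refine Subtype.ext ?_
    change dist (if (⟨k, g⟩ : Σ k, L.Functions k) = ⟨k, f⟩ then (1 : I) else 0) 0 = (b : ℝ)
    rw [hb, Subtype.dist_eq, Real.dist_eq, Set.Icc.coe_zero, sub_zero, abs_of_nonneg b.2.1]
  refine ⟨M, fun _ => ⟨0⟩, hf f 1 (if_pos rfl), hf f' 0 (if_neg fun h => hne ?_)⟩
  simpa using h.symm

theorem IsSeparable.countable_term (hL : L.IsSeparable) : Countable (L.Term ℕ) := by
  have := hL.countable_functions
  infer_instance

/-! ### The space of codes is Polish -/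

/-- Each clause involves finitely many coordinates. The modulus clauses are closed because their
premises are strict inequalities, hence open, and their conclusions are not strict. -/
theorem isClosed_isCode : IsClosed {γ : L.RawCode | IsCode γ} := by
  have hd : ∀ s t, Continuous fun γ : L.RawCode => (γ.1 s t : ℝ) := fun s t => by fun_prop
  have hr : ∀ (R : Σ k, L.Relations k) (s), Continuous fun γ : L.RawCode => (γ.2 R s : ℝ) :=
    fun R s => by fun_prop
  have hlt : ∀ {k : ℕ} (s t : Fin k → L.Term ℕ) (c : ℝ),
      IsOpen {γ : L.RawCode | ∀ i, (γ.1 (s i) (t i) : ℝ) < c} := fun s t c => by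
    rw [Set.ofPred_forall]
    exact isOpen_iInter_of_finite fun i => isOpen_lt (hd _ _) continuous_const
  have : {γ : L.RawCode | IsCode γ} =
      {γ | (∀ s, (γ.1 s s : ℝ) = 0) ∧ (∀ s t, (γ.1 s t : ℝ) = γ.1 t s) ∧
        (∀ s t r, (γ.1 s r : ℝ) ≤ γ.1 s t + γ.1 t r) ∧
        (∀ (f : Σ k, L.Functions k) (ε : Set.Ioc (0 : ℝ) 1) (s t : Fin f.1 → L.Term ℕ),
          (∀ i, (γ.1 (s i) (t i) : ℝ) < (L.funModulus f.2 ε : ℝ)) →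
            (γ.1 (.func f.2 s) (.func f.2 t) : ℝ) ≤ ε) ∧
        ∀ (R : Σ k, L.Relations k) (ε : Set.Ioc (0 : ℝ) 1) (s t : Fin R.1 → L.Term ℕ),
          (∀ i, (γ.1 (s i) (t i) : ℝ) < (L.relModulus R.2 ε : ℝ)) →
            |(γ.2 R s : ℝ) - γ.2 R t| ≤ ε} := by
    ext γ
    exact ⟨fun h => ⟨fun s => congrArg Subtype.val (h.self s),
        fun s t => congrArg Subtype.val (h.symm s t), h.triangle,
        fun f => h.func f.2, fun R => h.rel R.2⟩,
      fun h => ⟨fun s => Subtype.ext (h.1 s), fun s t => Subtype.ext (h.2.1 s t), h.2.2.1,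
        fun f => h.2.2.2.1 ⟨_, f⟩, fun R => h.2.2.2.2 ⟨_, R⟩⟩⟩
  rw [this]
  refine IsClosed.and ?_ (IsClosed.and ?_ (IsClosed.and ?_ (IsClosed.and ?_ ?_)))
  · simp only [Set.ofPred_forall]
    exact isClosed_iInter fun s => isClosed_eq (hd _ _) continuous_const
  · simp only [Set.ofPred_forall]
    exact isClosed_iInter fun s => isClosed_iInter fun t => isClosed_eq (hd _ _) (hd _ _)
  · simp only [Set.ofPred_forall]
    exact isClosed_iInter fun s => isClosed_iInter fun t => isClosed_iInter fun r =>
      isClosed_le (hd _ _) ((hd _ _).add (hd _ _))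
  · rw [Set.ofPred_forall]
    refine isClosed_iInter fun f => ?_
    simp only [Set.ofPred_forall]
    exact isClosed_iInter fun ε => isClosed_iInter fun s => isClosed_iInter fun t =>
      isClosed_imp (hlt s t _) (isClosed_le (hd _ _) continuous_const)
  · rw [Set.ofPred_forall]
    refine isClosed_iInter fun R => ?_
    simp only [Set.ofPred_forall]
    exact isClosed_iInter fun ε => isClosed_iInter fun s => isClosed_iInter fun t =>
      isClosed_imp (hlt s t _) (isClosed_le ((hr R s).sub (hr R t)).abs continuous_const)

theorem IsSeparable.polishSpace_code (hL : L.IsSeparable) : PolishSpace L.Code := by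
  have := hL.countable_term
  have := hL.countable_relations
  have : PolishSpace I := isClosed_Icc.polishSpace
  exact isClosed_isCode.polishSpace

/-! ### Formulas are uniformly continuous -/

theorem Str.uniformContinuous_termVal (M : L.Str) {n : ℕ} (t : L.Term (Fin n)) :
    UniformContinuous fun a : Fin n → M => M.termVal a t := by
  induction t with
  | var i => exact Pi.uniformContinuous_proj _ i
  | func f ts ih =>
    exact (M.funMap_respects f).uniformContinuous.comp (uniformContinuous_pi.2 ih)

theorem dist_snoc_snoc_le {X : Type*} [PseudoMetricSpace X] {n : ℕ} (a a' : Fin n → X) (b : X) :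
    dist (Fin.snoc a b : Fin (n + 1) → X) (Fin.snoc a' b : Fin (n + 1) → X) ≤ dist a a' := by
  refine (dist_pi_le_iff dist_nonneg).2 fun i => ?_
  induction i using Fin.lastCases with
  | last => simp
  | cast i => simpa using dist_le_pi_dist a a' i

theorem Str.uniformContinuous_eval (M : L.Str) {n : ℕ} (φ : L.Formula n) :
    UniformContinuous fun a : Fin n → M => M.eval φ a := by
  induction φ with
  | dist s t =>
    exact ((M.uniformContinuous_termVal s).dist (M.uniformContinuous_termVal t)).subtype_mk _
  | rel R ts =>
    exact (M.relMap_respects R).uniformContinuous.comp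
      (uniformContinuous_pi.2 fun i => M.uniformContinuous_termVal (ts i))
  | conn c φs ih =>
    exact (CompactSpace.uniformContinuous_of_continuous c.continuous).comp
      (uniformContinuous_pi.2 ih)
  | sup φ ih =>
    rw [Metric.uniformContinuous_iff] at ih ⊢
    intro ε hε
    obtain ⟨δ, hδ, h⟩ := ih (ε / 2) (half_pos hε)
    -- The same `δ` serves all `b`; `ε / 2` is used because a supremum preserves only non-strict
    -- bounds.
    refine ⟨δ, hδ, fun a a' haa' => (unitInterval.dist_iSup_le (half_pos hε).le fun b => ?_).trans_lt
      (half_lt_self hε)⟩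
    exact (h ((dist_snoc_snoc_le a a' b).trans_lt haa')).le
  | inf φ ih =>
    rw [Metric.uniformContinuous_iff] at ih ⊢
    intro ε hε
    obtain ⟨δ, hδ, h⟩ := ih (ε / 2) (half_pos hε)
    refine ⟨δ, hδ, fun a a' haa' => (unitInterval.dist_iInf_le (half_pos hε).le fun b => ?_).trans_lt
      (half_lt_self hε)⟩
    exact (h ((dist_snoc_snoc_le a a' b).trans_lt haa')).le

theorem continuous_snoc_right {X : Type*} [TopologicalSpace X] {n : ℕ} (a : Fin n → X) :
    Continuous fun b : X => (Fin.snoc a b : Fin (n + 1) → X) := by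
  refine continuous_pi fun i => ?_
  induction i using Fin.lastCases with
  | last => simpa using continuous_id'
  | cast i => simpa using continuous_const

/-! ### Evaluation of formulas at terms -/

namespace Code

/-- The element of `M(γ)` named by a term. -/
def point (γ : L.Code) (t : L.Term ℕ) : γ.model :=
  UniformSpace.Completion.coe' (α := γ.Pre) t

theorem denseRange_point (γ : L.Code) : DenseRange γ.point :=
  UniformSpace.Completion.denseRange_coe (α := γ.Pre)

theorem dist_point (γ : L.Code) (s t : L.Term ℕ) :
    dist (γ.point s) (γ.point t) = (γ.1.1 s t : ℝ) :=
  UniformSpace.Completion.dist_eq (α := γ.Pre) s t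

theorem funMap_point (γ : L.Code) {k : ℕ} (f : L.Functions k) (s : Fin k → L.Term ℕ) :
    γ.model.funMap f (fun i => γ.point (s i)) = γ.point (.func f s) := by
  have h : RespectsModulus (L.funModulus f)
      fun s => (γ.preFun f s : UniformSpace.Completion γ.Pre) := fun ε s t h => by
    rw [UniformSpace.Completion.dist_eq]
    exact γ.preFun_respects f ε s t h
  exact (extendCompletion_spec h).2 s

theorem relMap_point (γ : L.Code) {k : ℕ} (R : L.Relations k) (s : Fin k → L.Term ℕ) :
    γ.model.relMap R (fun i => γ.point (s i)) = γ.1.2 ⟨k, R⟩ s :=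
  (extendCompletion_spec (γ.preRel_respects R)).2 s

theorem termVal_point (γ : L.Code) {n : ℕ} (s : Fin n → L.Term ℕ) (t : L.Term (Fin n)) :
    γ.model.termVal (fun i => γ.point (s i)) t = γ.point (t.subst s) := by
  induction t with
  | var i => rfl
  | func f ts ih =>
    simp only [Str.termVal, ih, funMap_point, FirstOrder.Language.Term.subst]

theorem snoc_point (γ : L.Code) {n : ℕ} (s : Fin n → L.Term ℕ) (t : L.Term ℕ) :
    (Fin.snoc (fun i => γ.point (s i)) (γ.point t) : Fin (n + 1) → γ.model) =
      fun i => γ.point ((Fin.snoc s t : Fin (n + 1) → L.Term ℕ) i) :=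
  (Fin.comp_snoc γ.point s t).symm

theorem separableSpace_model (hL : L.IsSeparable) (γ : L.Code) :
    TopologicalSpace.SeparableSpace γ.model :=
  have := hL.countable_term
  ⟨_, Set.countable_range _, γ.denseRange_point⟩

theorem measurable_eval (hL : L.IsSeparable) {n : ℕ} (φ : L.Formula n) :
    ∀ s : Fin n → L.Term ℕ,
      Measurable fun γ : L.Code => γ.model.eval φ fun i => γ.point (s i) := by
  have := hL.countable_term
  have hval : Continuous fun γ : L.Code => (γ.1 : L.RawCode) := continuous_subtype_val
  induction φ with
  | dist t t' =>
    intro s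
    have h : (fun γ : L.Code => γ.model.eval (.dist t t') fun i => γ.point (s i)) =
        fun γ => γ.1.1 (t.subst s) (t'.subst s) := by
      funext γ
      refine Subtype.ext ?_
      simp only [Str.eval, termVal_point, dist_point]
    rw [h]
    exact Continuous.measurable (by fun_prop)
  | @rel _ k R ts =>
    intro s
    have h : (fun γ : L.Code => γ.model.eval (.rel R ts) fun i => γ.point (s i)) =
        fun γ => γ.1.2 ⟨k, R⟩ fun i => (ts i).subst s := by
      funext γ
      simp only [Str.eval, termVal_point, relMap_point]
    rw [h]
    exact Continuous.measurable (by fun_prop)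
  | conn c φs ih =>
    intro s
    exact c.continuous.measurable.comp (measurable_pi_lambda _ fun i => ih i s)
  | sup φ ih =>
    intro s
    have h : (fun γ : L.Code => γ.model.eval (.sup φ) fun i => γ.point (s i)) =
        fun γ => ⨆ t, γ.model.eval φ
          fun i => γ.point ((Fin.snoc s t : Fin _ → L.Term ℕ) i) := by
      funext γ
      simp only [← snoc_point]
      exact γ.denseRange_point.iSup_comp_of_continuous
        ((γ.model.uniformContinuous_eval φ).continuous.comp (continuous_snoc_right _))
    rw [h]
    exact Measurable.iSup fun t => ih _
  | inf φ ih =>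
    intro s
    have h : (fun γ : L.Code => γ.model.eval (.inf φ) fun i => γ.point (s i)) =
        fun γ => ⨅ t, γ.model.eval φ
          fun i => γ.point ((Fin.snoc s t : Fin _ → L.Term ℕ) i) := by
      funext γ
      simp only [← snoc_point]
      exact γ.denseRange_point.iInf_comp_of_continuous
        ((γ.model.uniformContinuous_eval φ).continuous.comp (continuous_snoc_right _))
    rw [h]
    exact Measurable.iInf fun t => ih _

end Code

/-! ### Models of a theory -/

/-- Over a separable language every theory contains a countable subset that is dense in it. -/
theorem IsSeparable.exists_countable_dense_subset (hL : L.IsSeparable) {n : ℕ}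
    (T : Set (L.Formula n)) :
    ∃ S ⊆ T, S.Countable ∧ ∀ φ ∈ T, ∀ r : ℝ, 0 < r → ∃ ψ ∈ S, φ.NormSubLE ψ r := by
  obtain ⟨A, hA, hd⟩ := hL n
  have := hA.to_subtype
  -- The dense set `A` need not meet `T`, so one member of `T` is picked near each element of `A`,
  -- at each precision where one exists.
  let B : Set (A × ℕ) := {p | ∃ φ ∈ T, φ.NormSubLE p.1.1 (1 / (p.2 + 1))}
  choose F hFT hF using fun p : B => p.2
  refine ⟨Set.range F, Set.range_subset_iff.2 hFT, Set.countable_range F, fun φ hφ r hr => ?_⟩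
  obtain ⟨m, hm⟩ := exists_nat_one_div_lt (half_pos hr)
  obtain ⟨ψ, hψ, hn⟩ := hd φ (1 / (m + 1)) (by positivity)
  refine ⟨_, ⟨⟨(⟨ψ, hψ⟩, m), φ, hφ, hn⟩, rfl⟩, fun M a => ?_⟩
  have h1 := abs_le.1 (hn M a)
  have h2 := abs_le.1 (hF ⟨(⟨ψ, hψ⟩, m), φ, hφ, hn⟩ M a)
  simp only at h2
  exact abs_le.2 ⟨by linarith [h1.1, h2.2], by linarith [h1.2, h2.1]⟩

theorem IsSeparable.exists_countable_axioms (hL : L.IsSeparable) (T : L.Theory) :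
    ∃ S : L.Theory, S.Countable ∧ ∀ M : L.Str, M.Models T ↔ M.Models S := by
  obtain ⟨S, hST, hS, hd⟩ := hL.exists_countable_dense_subset T
  refine ⟨S, hS, fun M => ⟨fun h φ hφ => h φ (hST hφ), fun h φ hφ => Subtype.ext ?_⟩⟩
  refine le_antisymm (le_of_forall_pos_le_add fun r hr => ?_) (M.eval φ Fin.elim0).2.1
  obtain ⟨ψ, hψ, hn⟩ := hd φ hφ r hr
  have h1 := (abs_le.1 (hn M Fin.elim0)).2
  rw [h ψ hψ, Set.Icc.coe_zero] at h1
  rw [Set.Icc.coe_zero]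
  linarith

theorem IsSeparable.measurableSet_models (hL : L.IsSeparable) (T : L.Theory) :
    MeasurableSet {γ : L.Code | γ.model.Models T} := by
  obtain ⟨S, hS, h⟩ := hL.exists_countable_axioms T
  have : {γ : L.Code | γ.model.Models T} =
      ⋂ φ ∈ S, {γ : L.Code | γ.model.eval φ Fin.elim0 = 0} := by
    ext γ
    simp only [Set.mem_ofPred_eq, h, Set.mem_iInter]
    rfl
  rw [this]
  refine MeasurableSet.biInter hS fun φ _ => ?_
  have hm := Code.measurable_eval hL φ Fin.elim0
  have he : ∀ γ : L.Code, (fun i : Fin 0 => γ.point ((Fin.elim0 : Fin 0 → L.Term ℕ) i)) =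
    Fin.elim0 := fun γ => Subsingleton.elim _ _
  simp only [he] at hm
  exact hm (measurableSet_singleton 0)

theorem IsSeparable.standardBorelSpace_modelSpace (hL : L.IsSeparable) (T : L.Theory) :
    StandardBorelSpace (ModelSpace T) := by
  have := hL.polishSpace_code
  exact (hL.measurableSet_models T).standardBorel

/-! ### Omitting uniform sequences of types -/

theorem Str.omits_range_ge_iff (M : L.Str) {n : ℕ} (φ : ℕ → L.Formula n) (r : ℝ) :
    M.Omits (Set.range fun i => (φ i).ge r) ↔
      ∀ a : Fin n → M, ∃ i, (M.eval (φ i) a : ℝ) < r := by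
  simp only [Str.Omits, Str.Realizes, Set.forall_mem_range, not_exists, not_forall]
  exact forall_congr' fun a => exists_congr fun i => not_le (a := r)

theorem Code.omits_iff (γ : L.Code) {n : ℕ} {φ : ℕ → L.Formula n} {Δ : Modulus}
    (hφ : ∀ i, (φ i).HasModulus Δ) :
    (∀ j : ℕ, γ.model.Omits (Set.range fun i => (φ i).ge ((2 : ℝ)⁻¹ ^ j))) ↔
      ∀ (j : ℕ) (s : Fin n → L.Term ℕ), ∃ i,
        (γ.model.eval (φ i) (fun l => γ.point (s l)) : ℝ) < (2 : ℝ)⁻¹ ^ j := by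
  simp only [Str.omits_range_ge_iff]
  refine ⟨fun h j s => h j _, fun h j a => ?_⟩
  -- Half of `2⁻ʲ` is spent on moving from `a` to terms, the other half on the bound at those terms.
  -- The index `i` depends on the chosen terms, so the modulus must not depend on `i`.
  let ε : Set.Ioc (0 : ℝ) 1 :=
    ⟨(2 : ℝ)⁻¹ ^ (j + 1), by positivity, pow_le_one₀ (by norm_num) (by norm_num)⟩
  choose s hs using fun l => γ.denseRange_point.exists_dist_lt (a l) (Δ ε).2.1
  obtain ⟨i, hi⟩ := h (j + 1) s
  have hd := (abs_le.1 (hφ i γ.model ε _ _ hs)).2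
  refine ⟨i, ?_⟩
  have h2 : (2 : ℝ)⁻¹ ^ (j + 1) = (2 : ℝ)⁻¹ ^ j / 2 := by rw [pow_succ]; ring
  change _ ≤ (2 : ℝ)⁻¹ ^ (j + 1) at hd
  linarith

theorem IsSeparable.measurableSet_omits (hL : L.IsSeparable) {n : ℕ}
    {t : ℕ → L.PartialType n} (ht : IsUniformSequence t) :
    MeasurableSet {γ : L.Code | ∀ j, γ.model.Omits (t j)} := by
  have := hL.countable_term
  obtain ⟨φ, ht, Δ, hφ⟩ := ht
  simp only [ht, Code.omits_iff _ hφ, Set.ofPred_forall, Set.ofPred_exists]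
  exact .iInter fun j => .iInter fun s => .iUnion fun i =>
    measurableSet_lt (Code.measurable_eval hL (φ i) s).subtype_val measurable_const

end MetricLanguage

theorem propositionP (L : MetricLanguage.{u}) (hL : L.IsSeparable) (T : L.Theory)
    (𝔐 : Set L.Str) (h𝔐 : MetricLanguage.UniformlyDefinableByOmittingTypes T 𝔐) :
    StandardBorelSpace (MetricLanguage.ModelSpace T) ∧
      MeasurableSet {γ : MetricLanguage.ModelSpace T | γ.1.model ∈ 𝔐} := by
  refine ⟨hL.standardBorelSpace_modelSpace T, ?_⟩
  obtain ⟨J, _, n, t, ht, h⟩ := h𝔐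
  have : {γ : MetricLanguage.ModelSpace T | γ.1.model ∈ 𝔐} =
      Subtype.val ⁻¹' ⋂ m, {γ : L.Code | ∀ j, γ.model.Omits (t m j)} := by
    ext γ
    simp only [Set.mem_ofPred_eq, Set.mem_preimage, Set.mem_iInter, h]
    -- On the model space, separability and being a model are automatic; only omission remains.
    exact ⟨fun hγ => hγ.2.2, fun hγ => ⟨γ.1.separableSpace_model hL, γ.2, hγ⟩⟩
  rw [this]
  exact measurable_subtype_coe (.iInter fun m => hL.measurableSet_omits (ht m))
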